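/- Consider the call-by-value simply typed $\lambda$-calculus with recursion, Booleans and symbols. Its types are $\tau ::= b \mid \tau_1\to\tau_2 \mid \mathsf{sym}$ with base types $b ::= \mathsf{unit}\mid\mathsf{bool}$, and its expressions are $$M ::= \mathsf{fail} \mid () \mid \mathsf{true}\mid\mathsf{false}\mid x \mid \lambda x.M \mid M_1M_2 \mid Y(\lambda f.\lambda x.M) \mid \mathsf{if}\ M_0\ \mathsf{then}\ M_1\ \mathsf{else}\ M_2 \mid \mathsf{gensym} \mid M_1 = M_2 \mid \ell,$$ where $\ell$ ranges over a denumerable set of labels (symbols) that appear only at run time and have no typing rule. The typing rules are the standard ones of the simply typed $\lambda$-calculus, with $\Gamma\vdash\mathsf{fail}:\tau$ for every $\tau$; $\Gamma\vdash Y(\lambda f.\lambda x.M):\tau_1\to\tau_2$ if $\Gamma,f:\tau_1\to\tau_2,x:\tau_1\vdash M:\tau_2$; $\Gamma\vdash\mathsf{gensym}:\mathsf{sym}$; and $\Gamma\vdash M_1=M_2:\mathsf{bool}$ if $\Gamma\vdash M_1:\mathsf{sym}$ and $\Gamma\vdash M_2:\mathsf{sym}$. Values are $V ::= ()\mid\mathsf{true}\mid\mathsf{false}\mid\lambda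 x.M\mid\ell$, evaluation contexts are $E ::= [\,]\mid E\,M\mid V\,E\mid \mathsf{if}\ E\ \mathsf{then}\ M_1\ \mathsf{else}\ M_2\mid E=M\mid \ell=E$, and reduction $\longrightarrow$ is given by $$\begin{aligned} &E[(\lambda x.M)V]\longrightarrow E[[V/x]M], \qquad E[\mathsf{fail}]\longrightarrow\mathsf{fail},\\ &E[\mathsf{if}\ \mathsf{true}\ \mathsf{then}\ M_1\ \mathsf{else}\ M_2]\longrightarrow E[M_1],\qquad E[\mathsf{if}\ \mathsf{false}\ \mathsf{then}\ M_1\ \mathsf{else}\ M_2]\longrightarrow E[M_2],\\ &E[Y(\lambda f.\lambda x.M)]\longrightarrow E[\lambda x.[Y(\lambda f.\lambda x.M)/f]M],\\ &E[\mathsf{gensym}]\longrightarrow E[\ell]\ \text{ if $\ell$ does not occur in $E$},\\ &E[\ell=\ell]\longrightarrow E[\mathsf{true}],\qquad E[\ell_1=\ell_2]\longrightarrow E[\mathsf{false}]\ \text{ if }\ell_1\neq\ell_2. \end{aligned}$$ Let $\longrightarrow^*$ be the reflexive transitive closure of $\longrightarrow$. **Theorem.** The reachability problem for this language is undecidable: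 there is no algorithm (partial recursive function on codes of expressions) that, given any closed expression $M$ with $\vdash M:b$ for some base type $b$, terminates and answers correctly whether $M\longrightarrow^*\mathsf{fail}$. -/

import Mathlib

namespace BPCFL

/-- Base types. -/
inductive BaseTy : Type
  | unit
  | bool

/-- Simple types: base types, function types and the type of symbols. -/
inductive Ty : Type
  | base (b : BaseTy)
  | arrow (σ τ : Ty)
  | sym

/-- Expressions, with de Bruijn indices for variables.
`lam M` is `λx. M`, where `x` is index `0` in `M`.
`fix M` is the recursive function `Y(λf. λx. M)`, where `x` is index `0` and `f` is index `1` in `M`.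
`label l` is a run-time symbol, drawn from the denumerable set `ℕ` of labels; it has no typing rule,
so it does not occur in a well-typed program. -/
inductive Tm : Type
  | fail
  | unit
  | bool (b : Bool)
  | var (n : ℕ)
  | lam (M : Tm)
  | app (M N : Tm)
  | fix (M : Tm)
  | cond (M₀ M₁ M₂ : Tm)
  | gensym
  | symEq (M N : Tm)
  | label (l : ℕ)

/-- The typing judgement `Γ ⊢ M : τ`; the type of variable `n` is the `n`-th entry of `Γ`. -/
inductive Typed : List Ty → Tm → Ty → Prop
  | fail {Γ : List Ty} {τ : Ty} : Typed Γ Tm.fail τ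
  | unit {Γ : List Ty} : Typed Γ Tm.unit (Ty.base BaseTy.unit)
  | bool {Γ : List Ty} {b : Bool} : Typed Γ (Tm.bool b) (Ty.base BaseTy.bool)
  | var {Γ : List Ty} {n : ℕ} {τ : Ty} : Γ[n]? = some τ → Typed Γ (Tm.var n) τ
  | lam {Γ : List Ty} {M : Tm} {σ τ : Ty} :
      Typed (σ :: Γ) M τ → Typed Γ (Tm.lam M) (Ty.arrow σ τ)
  | app {Γ : List Ty} {M N : Tm} {σ τ : Ty} :
      Typed Γ M (Ty.arrow σ τ) → Typed Γ N σ → Typed Γ (Tm.app M N) τ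
  | fix {Γ : List Ty} {M : Tm} {σ τ : Ty} :
      Typed (σ :: Ty.arrow σ τ :: Γ) M τ → Typed Γ (Tm.fix M) (Ty.arrow σ τ)
  | cond {Γ : List Ty} {M₀ M₁ M₂ : Tm} {τ : Ty} :
      Typed Γ M₀ (Ty.base BaseTy.bool) → Typed Γ M₁ τ → Typed Γ M₂ τ →
      Typed Γ (Tm.cond M₀ M₁ M₂) τ
  | gensym {Γ : List Ty} : Typed Γ Tm.gensym Ty.sym
  | symEq {Γ : List Ty} {M N : Tm} :
      Typed Γ M Ty.sym → Typed Γ N Ty.sym → Typed Γ (Tm.symEq M N) (Ty.base BaseTy.bool)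

/-- Lift a renaming of variables under one binder. -/
def upRen (ρ : ℕ → ℕ) : ℕ → ℕ
  | 0 => 0
  | n + 1 => ρ n + 1

/-- Renaming of the free variables. -/
def Tm.rename : (ℕ → ℕ) → Tm → Tm
  | _, .fail => .fail
  | _, .unit => .unit
  | _, .bool b => .bool b
  | ρ, .var n => .var (ρ n)
  | ρ, .lam M => .lam (M.rename (upRen ρ))
  | ρ, .app M N => .app (M.rename ρ) (N.rename ρ)
  | ρ, .fix M => .fix (M.rename (upRen (upRen ρ)))
  | ρ, .cond M₀ M₁ M₂ => .cond (M₀.rename ρ) (M₁.rename ρ) (M₂.rename ρ)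
  | _, .gensym => .gensym
  | ρ, .symEq M N => .symEq (M.rename ρ) (N.rename ρ)
  | _, .label l => .label l

/-- Lift a parallel substitution under one binder. -/
def upSub (σ : ℕ → Tm) : ℕ → Tm
  | 0 => .var 0
  | n + 1 => (σ n).rename Nat.succ

/-- Capture-avoiding parallel substitution. -/
def Tm.subst : (ℕ → Tm) → Tm → Tm
  | _, .fail => .fail
  | _, .unit => .unit
  | _, .bool b => .bool b
  | σ, .var n => σ n
  | σ, .lam M => .lam (M.subst (upSub σ))
  | σ, .app M N => .app (M.subst σ) (N.subst σ)
  | σ, .fix M => .fix (M.subst (upSub (upSub σ)))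
  | σ, .cond M₀ M₁ M₂ => .cond (M₀.subst σ) (M₁.subst σ) (M₂.subst σ)
  | _, .gensym => .gensym
  | σ, .symEq M N => .symEq (M.subst σ) (N.subst σ)
  | _, .label l => .label l

/-- The substitution that replaces variable `0` by `N` and lowers the other variables. -/
def single (N : Tm) : ℕ → Tm
  | 0 => N
  | n + 1 => .var n

/-- `M.inst N` is `[N/x]M`, where `x` is the variable with index `0` in `M`. -/
def Tm.inst (M N : Tm) : Tm :=
  M.subst (single N)

/-- Values. -/
inductive IsValue : Tm → Prop
  | unit : IsValue Tm.unit
  | bool (b : Bool) : IsValue (Tm.bool b)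
  | lam (M : Tm) : IsValue (Tm.lam M)
  | label (l : ℕ) : IsValue (Tm.label l)

/-- Call-by-value evaluation contexts
`E ::= [] | E M | V E | if E then M₁ else M₂ | E = M | l = E`. -/
inductive ECtx : Type
  | hole
  | appL (E : ECtx) (M : Tm)
  | appR (V : Tm) (hV : IsValue V) (E : ECtx)
  | cond (E : ECtx) (M₁ M₂ : Tm)
  | symEqL (E : ECtx) (M : Tm)
  | symEqR (l : ℕ) (E : ECtx)

/-- `E.plug M` is `E[M]`. -/
def ECtx.plug : ECtx → Tm → Tm
  | .hole, N => N
  | .appL E M, N => .app (E.plug N) M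
  | .appR V _ E, N => .app V (E.plug N)
  | .cond E M₁ M₂, N => .cond (E.plug N) M₁ M₂
  | .symEqL E M, N => .symEq (E.plug N) M
  | .symEqR l E, N => .symEq (.label l) (E.plug N)

/-- The label `l` occurs in an expression. -/
def Tm.Occurs (l : ℕ) : Tm → Prop
  | .fail => False
  | .unit => False
  | .bool _ => False
  | .var _ => False
  | .lam M => M.Occurs l
  | .app M N => M.Occurs l ∨ N.Occurs l
  | .fix M => M.Occurs l
  | .cond M₀ M₁ M₂ => M₀.Occurs l ∨ M₁.Occurs l ∨ M₂.Occurs l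
  | .gensym => False
  | .symEq M N => M.Occurs l ∨ N.Occurs l
  | .label k => k = l

/-- The label `l` occurs in an evaluation context. -/
def ECtx.Occurs (l : ℕ) : ECtx → Prop
  | .hole => False
  | .appL E M => E.Occurs l ∨ M.Occurs l
  | .appR V _ E => V.Occurs l ∨ E.Occurs l
  | .cond E M₁ M₂ => E.Occurs l ∨ M₁.Occurs l ∨ M₂.Occurs l
  | .symEqL E M => E.Occurs l ∨ M.Occurs l
  | .symEqR k E => k = l ∨ E.Occurs l

/-- The one-step reduction relation. In the rule `fix`, the term `(Tm.lam M).inst (Tm.fix M)` is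
`λx. [Y(λf. λx. M)/f]M`. -/
inductive Red : Tm → Tm → Prop
  | beta (E : ECtx) (M V : Tm) (hV : IsValue V) :
      Red (E.plug (Tm.app (Tm.lam M) V)) (E.plug (M.inst V))
  | condTrue (E : ECtx) (M₁ M₂ : Tm) :
      Red (E.plug (Tm.cond (Tm.bool true) M₁ M₂)) (E.plug M₁)
  | condFalse (E : ECtx) (M₁ M₂ : Tm) :
      Red (E.plug (Tm.cond (Tm.bool false) M₁ M₂)) (E.plug M₂)
  | fail (E : ECtx) : Red (E.plug Tm.fail) Tm.fail
  | fix (E : ECtx) (M : Tm) :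
      Red (E.plug (Tm.fix M)) (E.plug ((Tm.lam M).inst (Tm.fix M)))
  | gensym (E : ECtx) (l : ℕ) (hl : ¬ E.Occurs l) :
      Red (E.plug Tm.gensym) (E.plug (Tm.label l))
  | symEqTrue (E : ECtx) (l : ℕ) :
      Red (E.plug (Tm.symEq (Tm.label l) (Tm.label l))) (E.plug (Tm.bool true))
  | symEqFalse (E : ECtx) (l₁ l₂ : ℕ) (h : l₁ ≠ l₂) :
      Red (E.plug (Tm.symEq (Tm.label l₁) (Tm.label l₂))) (E.plug (Tm.bool false))

/-- `M` reduces in zero or more steps to `fail`. -/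
def ReachesFail (M : Tm) : Prop :=
  Relation.ReflTransGen Red M Tm.fail

/-- A Gödel numbering of expressions: a constructor tag paired with the codes of the arguments. -/
def Tm.code : Tm → ℕ
  | .fail => Nat.pair 0 0
  | .unit => Nat.pair 1 0
  | .bool b => Nat.pair 2 b.toNat
  | .var n => Nat.pair 3 n
  | .lam M => Nat.pair 4 M.code
  | .app M N => Nat.pair 5 (Nat.pair M.code N.code)
  | .fix M => Nat.pair 6 M.code
  | .cond M₀ M₁ M₂ => Nat.pair 7 (Nat.pair M₀.code (Nat.pair M₁.code M₂.code))
  | .gensym => Nat.pair 8 0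
  | .symEq M N => Nat.pair 9 (Nat.pair M.code N.code)
  | .label l => Nat.pair 10 l

theorem Tm.code_injective : Function.Injective Tm.code := by
  intro M
  induction M <;> intro N h <;> cases N <;> simp_all [Tm.code, Nat.pair_eq_pair]
  case bool.bool a b => cases a <;> cases b <;> simp_all
  all_goals grind

/-- The partial function `f` solves the reachability problem: on (the code of) every closed
expression `M` of base type, `f` terminates, and answers `true` exactly if `M` reduces to `fail`.
Nothing is required of `f` on other inputs. -/
def SolvesReachability (f : ℕ →. Bool) : Prop :=
  ∀ (M : Tm) (b : BaseTy), Typed [] M (Ty.base b) →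
    ∃ r ∈ f M.code, (r = true ↔ ReachesFail M)

end BPCFL

/-!
Symbols serve as addresses and functions as memory: a heap is an expression of type
`sym → bool → sym` that returns the two components of the cell named by a symbol, and `gensym`
allocates. Numbers and lists of numbers live in such a heap, so in continuation-passing style every
partial recursive function can be programmed at simple types, with a final continuation that fails
exactly if the result is zero. Only terminating runs need to be analysed: applied to the partial
recursive function that runs the `e`-th program on `e`, a solution of the reachability problem is
refuted on the index of the program that returns a nonzero number exactly if the solution predicts
failure.
-/

namespace BPCFL

/-! ### Redexes and unique decomposition -/

/-- Contraction of the redexes other than `fail`, which discards its evaluation context, and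
`gensym`, whose contractum is not unique. -/
inductive Contracts : Tm → Tm → Prop
  | beta (M V : Tm) (hV : IsValue V) : Contracts (.app (.lam M) V) (M.inst V)
  | condTrue (M₁ M₂ : Tm) : Contracts (.cond (.bool true) M₁ M₂) M₁
  | condFalse (M₁ M₂ : Tm) : Contracts (.cond (.bool false) M₁ M₂) M₂
  | fix (M : Tm) : Contracts (.fix M) ((Tm.lam M).inst (.fix M))
  | symEqTrue (l : ℕ) : Contracts (.symEq (.label l) (.label l)) (.bool true)
  | symEqFalse (l₁ l₂ : ℕ) (h : l₁ ≠ l₂) :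
      Contracts (.symEq (.label l₁) (.label l₂)) (.bool false)

/-- Redexes of the reduction relation. -/
inductive IsRedex : Tm → Prop
  | contracts {M N : Tm} (h : Contracts M N) : IsRedex M
  | fail : IsRedex .fail
  | gensym : IsRedex .gensym

/-- `RedexStep E r N` means that the reduction step at the redex `r` turns `E[r]` into `N`. -/
inductive RedexStep (E : ECtx) : Tm → Tm → Prop
  | contracts {r r' : Tm} (h : Contracts r r') : RedexStep E r (E.plug r')
  | fail : RedexStep E .fail .fail
  | gensym (l : ℕ) (hl : ¬ E.Occurs l) : RedexStep E .gensym (E.plug (.label l))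

theorem RedexStep.isRedex {E : ECtx} {r N : Tm} (h : RedexStep E r N) : IsRedex r := by
  cases h with
  | contracts h => exact .contracts h
  | fail => exact .fail
  | gensym => exact .gensym

theorem Contracts.red {r r' : Tm} (h : Contracts r r') (E : ECtx) :
    Red (E.plug r) (E.plug r') := by
  cases h <;> constructor <;> assumption

theorem Red.exists_redexStep {M N : Tm} (h : Red M N) :
    ∃ E r, M = ECtx.plug E r ∧ RedexStep E r N := by
  cases h with
  | beta E M V hV => exact ⟨E, _, rfl, .contracts (.beta M V hV)⟩
  | condTrue E M₁ M₂ => exact ⟨E, _, rfl, .contracts (.condTrue M₁ M₂)⟩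
  | condFalse E M₁ M₂ => exact ⟨E, _, rfl, .contracts (.condFalse M₁ M₂)⟩
  | fail E => exact ⟨E, _, rfl, .fail⟩
  | fix E M => exact ⟨E, _, rfl, .contracts (.fix M)⟩
  | gensym E l hl => exact ⟨E, _, rfl, .gensym l hl⟩
  | symEqTrue E l => exact ⟨E, _, rfl, .contracts (.symEqTrue l)⟩
  | symEqFalse E l₁ l₂ h => exact ⟨E, _, rfl, .contracts (.symEqFalse l₁ l₂ h)⟩

theorem IsRedex.not_isValue {r : Tm} (hr : IsRedex r) : ¬ IsValue r := by
  rintro (_ | _ | _ | _) <;> rcases hr with ⟨⟨⟩⟩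

theorem IsRedex.not_isValue_plug {r : Tm} (hr : IsRedex r) (E : ECtx) : ¬ IsValue (E.plug r) := by
  cases E with
  | hole => exact hr.not_isValue
  | _ => rintro ⟨⟩

theorem IsRedex.eq_hole {r r' : Tm} (hr : IsRedex r) (hr' : IsRedex r') {E : ECtx}
    (e : r = E.plug r') : E = .hole := by
  have not_value := hr'.not_isValue_plug
  rcases hr with ⟨_ | _ | _ | _ | _ | _⟩ <;>
    rcases E with _ | E | ⟨_, _, E⟩ | E | E | ⟨_, E⟩ <;> simp only [ECtx.plug] at e <;>
    grind [IsValue]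

theorem IsRedex.plug_inj {r r' : Tm} (hr : IsRedex r) (hr' : IsRedex r') {E E' : ECtx}
    (e : E.plug r = E'.plug r') : E = E' ∧ r = r' := by
  have not_value := hr.not_isValue_plug
  have not_value' := hr'.not_isValue_plug
  have eq_hole (F : ECtx) : r = F.plug r' → F = .hole := hr.eq_hole hr'
  have eq_hole' (F : ECtx) : r' = F.plug r → F = .hole := hr'.eq_hole hr
  induction E generalizing E' <;> cases E' <;> grind [ECtx.plug, IsValue]

theorem IsRedex.redexStep_of_red {r N : Tm} (hr : IsRedex r) {E : ECtx} (h : Red (E.plug r) N) :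
    RedexStep E r N := by
  obtain ⟨E', r', e, hstep⟩ := h.exists_redexStep
  obtain ⟨rfl, rfl⟩ := hr.plug_inj hstep.isRedex e
  exact hstep

theorem IsValue.not_red {V N : Tm} (hV : IsValue V) : ¬ Red V N := by
  intro h
  obtain ⟨E, r, rfl, hstep⟩ := h.exists_redexStep
  exact hstep.isRedex.not_isValue_plug E hV

theorem IsValue.not_reachesFail {V : Tm} (hV : IsValue V) : ¬ ReachesFail V := by
  intro h
  rcases h.cases_head with rfl | ⟨N, hN, -⟩
  · cases hV
  · exact hV.not_red hN

theorem Contracts.unique {r r₁ r₂ : Tm} (h₁ : Contracts r r₁) (h₂ : Contracts r r₂) :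
    r₁ = r₂ := by
  cases h₁ <;> cases h₂ <;> first | rfl | contradiction

theorem Contracts.eq_of_red {r r' N : Tm} (h : Contracts r r') {E : ECtx}
    (hN : Red (E.plug r) N) : N = E.plug r' := by
  cases (IsRedex.contracts h).redexStep_of_red hN with
  | contracts h' => rw [h.unique h']
  | fail => cases h
  | gensym => cases h

/-! ### Equivalence with respect to reachability of `fail` -/

/-- `M` and `N` behave alike, with respect to reaching `fail`, in all evaluation contexts. -/
def FailEquiv (M N : Tm) : Prop :=
  ∀ E : ECtx, ReachesFail (E.plug M) ↔ ReachesFail (E.plug N)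

/-- Composition of evaluation contexts: `(E.comp F)[M] = E[F[M]]`. -/
def ECtx.comp : ECtx → ECtx → ECtx
  | .hole, F => F
  | .appL E M, F => .appL (E.comp F) M
  | .appR V hV E, F => .appR V hV (E.comp F)
  | .cond E M₁ M₂, F => .cond (E.comp F) M₁ M₂
  | .symEqL E M, F => .symEqL (E.comp F) M
  | .symEqR l E, F => .symEqR l (E.comp F)

theorem ECtx.plug_comp (E F : ECtx) (M : Tm) : (E.comp F).plug M = E.plug (F.plug M) := by
  induction E <;> simp_all [ECtx.comp, ECtx.plug]

theorem Contracts.failEquiv {r r' : Tm} (h : Contracts r r') : FailEquiv r r' := by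
  refine fun E => ⟨fun hf => ?_, .head (h.red E)⟩
  rcases hf.cases_head with e | ⟨N, hN, hf⟩
  · obtain ⟨-, rfl⟩ := IsRedex.plug_inj (E' := .hole) (.contracts h) .fail e
    cases h
  · rwa [h.eq_of_red hN] at hf

namespace FailEquiv

theorem refl (M : Tm) : FailEquiv M M := fun _ => Iff.rfl

theorem trans {M N P : Tm} (h : FailEquiv M N) (h' : FailEquiv N P) : FailEquiv M P :=
  fun E => (h E).trans (h' E)

theorem reachesFail_iff {M N : Tm} (h : FailEquiv M N) : ReachesFail M ↔ ReachesFail N :=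
  h .hole

theorem plug {M N : Tm} (h : FailEquiv M N) (F : ECtx) : FailEquiv (F.plug M) (F.plug N) := by
  intro E
  rw [← ECtx.plug_comp, ← ECtx.plug_comp]
  exact h _

theorem appL {M N : Tm} (h : FailEquiv M N) (P : Tm) : FailEquiv (.app M P) (.app N P) :=
  h.plug (.appL .hole P)

theorem appR {M N V : Tm} (h : FailEquiv M N) (hV : IsValue V) :
    FailEquiv (.app V M) (.app V N) :=
  h.plug (.appR V hV .hole)

theorem cond_of_bool {M : Tm} {b : Bool} (h : FailEquiv M (.bool b)) (P Q : Tm) :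
    FailEquiv (.cond M P Q) (bif b then P else Q) := by
  refine (h.plug (.cond .hole P Q)).trans ?_
  cases b
  · exact (Contracts.condFalse P Q).failEquiv
  · exact (Contracts.condTrue P Q).failEquiv

theorem symEq_of_label {M : Tm} {l l' : ℕ} (h : FailEquiv M (.label l')) :
    FailEquiv (.symEq (.label l) M) (.bool (decide (l = l'))) := by
  refine (h.plug (.symEqR l .hole)).trans ?_
  by_cases e : l = l'
  · rw [decide_eq_true e, e]
    exact (Contracts.symEqTrue l').failEquiv
  · rw [decide_eq_false e]
    exact (Contracts.symEqFalse l l' e).failEquiv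

theorem beta (M : Tm) {V : Tm} (hV : IsValue V) : FailEquiv (.app (.lam M) V) (M.inst V) :=
  (Contracts.beta M V hV).failEquiv

theorem beta₂ (M : Tm) {V W : Tm} (hV : IsValue V) (hW : IsValue W) :
    FailEquiv (.app (.app (.lam (.lam M)) V) W)
      ((M.subst (upSub (single V))).subst (single W)) :=
  ((beta _ hV).appL _).trans (beta _ hW)

theorem beta₃ (M : Tm) {V W X : Tm} (hV : IsValue V) (hW : IsValue W) (hX : IsValue X) :
    FailEquiv (.app (.app (.app (.lam (.lam (.lam M))) V) W) X)
      (((M.subst (upSub (upSub (single V)))).subst (upSub (single W))).subst (single X)) :=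
  ((beta₂ _ hV hW).appL _).trans (beta _ hX)

end FailEquiv

theorem Tm.finite_setOf_occurs (M : Tm) : {l | M.Occurs l}.Finite := by
  induction M <;> simp_all [Tm.Occurs, Set.ofPred_or]

theorem reachesFail_let_gensym {N : Tm} {P : Prop}
    (h : ∀ l, ¬ N.Occurs l → (ReachesFail (N.inst (.label l)) ↔ P)) :
    ReachesFail (.app (.lam N) .gensym) ↔ P := by
  let E : ECtx := .appR (.lam N) (.lam N) .hole
  have fresh_iff {l : ℕ} : E.Occurs l ↔ N.Occurs l := iff_of_eq (or_false _)
  constructor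
  · intro hf
    rcases hf.cases_head with e | ⟨M, hM, hf⟩
    · cases e
    · cases IsRedex.gensym.redexStep_of_red (E := E) hM with
      | contracts h' => cases h'
      | gensym l hl =>
        exact (h l (mt fresh_iff.2 hl)).1 ((FailEquiv.beta N (.label l)).reachesFail_iff.1 hf)
  · intro hP
    obtain ⟨l, hl⟩ := N.finite_setOf_occurs.exists_notMem
    exact .head (Red.gensym E l (mt fresh_iff.1 hl))
      ((FailEquiv.beta N (.label l)).reachesFail_iff.2 ((h l hl).2 hP))

/-- Closed expressions, characterized by what is needed of them: substitution and renaming leave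
them unchanged. Labels are allowed. -/
structure Tm.Closed (M : Tm) : Prop where
  subst_eq (σ : ℕ → Tm) : M.subst σ = M
  rename_eq (ρ : ℕ → ℕ) : M.rename ρ = M

theorem Tm.Closed.subst_upSub {N : Tm} (h : (Tm.lam N).Closed) (σ : ℕ → Tm) :
    N.subst (upSub σ) = N :=
  Tm.lam.inj (h.subst_eq σ)

theorem Tm.Closed.rename_upRen {N : Tm} (h : (Tm.lam N).Closed) (ρ : ℕ → ℕ) :
    N.rename (upRen ρ) = N :=
  Tm.lam.inj (h.rename_eq ρ)

/-! ### Heaps -/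

/-- A finite heap, as an association list: the entry `(s, a, d)` is a cell with name `s` and
components `a` and `d`. -/
abbrev Heap : Type := List (ℕ × ℕ × ℕ)

/-- The expression for a heap that maps `s` to `a` and `d` and is given by `h` elsewhere. The four
arguments are placed under two binders. -/
def extendTm (h s a d : Tm) : Tm :=
  .lam (.lam (.cond (.symEq (.var 1) s) (.cond (.var 0) a d) (.app (.app h (.var 1)) (.var 0))))

/-- The value of type `sym → bool → sym` that represents a heap. The Boolean selects the first
component of a cell if it is true. -/
def heapTm : Heap → Tm
  | [] => .lam (.lam (.var 1))
  | (s, a, d) :: L => extendTm (heapTm L) (.label s) (.label a) (.label d)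

theorem isValue_heapTm (L : Heap) : IsValue (heapTm L) := by
  cases L <;> exact .lam _

theorem closed_heapTm (L : Heap) : (heapTm L).Closed := by
  induction L with
  | nil => exact ⟨fun _ => rfl, fun _ => rfl⟩
  | cons c L ih =>
    constructor <;> intro <;>
      simp [heapTm, extendTm, Tm.subst, Tm.rename, upSub, upRen, ih.subst_eq, ih.rename_eq]

@[simp]
theorem heapTm_subst (L : Heap) (σ : ℕ → Tm) : (heapTm L).subst σ = heapTm L :=
  (closed_heapTm L).subst_eq σ

@[simp]
theorem heapTm_rename (L : Heap) (ρ : ℕ → ℕ) : (heapTm L).rename ρ = heapTm L :=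
  (closed_heapTm L).rename_eq ρ

theorem lookup_eq_none_of_not_occurs {L : Heap} {l : ℕ} (h : ¬ (heapTm L).Occurs l) :
    L.lookup l = none := by
  induction L with
  | nil => rfl
  | cons c L ih =>
    obtain ⟨s, a, d⟩ := c
    simp only [heapTm, extendTm, Tm.Occurs, not_or] at h
    rw [List.lookup_cons, beq_eq_false_iff_ne.2 (Ne.symm h.1.2)]
    exact ih h.2.2.1.1

theorem heapTm_app_failEquiv {L : Heap} {s a d : ℕ} (h : L.lookup s = some (a, d)) (b : Bool) :
    FailEquiv (.app (.app (heapTm L) (.label s)) (.bool b)) (.label (bif b then a else d)) := by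
  induction L with
  | nil => simp at h
  | cons c L ih =>
    obtain ⟨s', a', d'⟩ := c
    refine (FailEquiv.beta₂ _ (.label s) (.bool b)).trans ?_
    simp only [Tm.subst, upSub, single, Tm.rename, heapTm_subst]
    refine (FailEquiv.symEq_of_label (.refl _)).cond_of_bool _ _ |>.trans ?_
    rw [List.lookup_cons] at h
    by_cases e : s = s'
    · obtain ⟨rfl, rfl⟩ : a' = a ∧ d' = d := by simpa [e] using h
      rw [decide_eq_true e, cond_true]
      refine (FailEquiv.refl (.bool b)).cond_of_bool _ _ |>.trans ?_
      cases b <;> exact .refl _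
    · rw [decide_eq_false e, cond_false]
      exact ih (by simpa [beq_eq_false_iff_ne.2 e] using h)

/-- The heap `L'` extends the heap `L`: it agrees with `L` on the cells of `L`. -/
def Heap.Subheap (L L' : Heap) : Prop :=
  ∀ s c, L.lookup s = some c → L'.lookup s = some c

theorem Heap.Subheap.refl (L : Heap) : L.Subheap L := fun _ _ h => h

theorem Heap.Subheap.trans {L L' L'' : Heap} (h : L.Subheap L') (h' : L'.Subheap L'') :
    L.Subheap L'' :=
  fun s c e => h' s c (h s c e)

theorem Heap.Subheap.cons {L : Heap} {s : ℕ} (h : L.lookup s = none) (c : ℕ × ℕ) :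
    L.Subheap ((s, c) :: L) := by
  intro t e ht
  have hts : t ≠ s := by
    rintro rfl
    simp [h] at ht
  rwa [List.lookup_cons, beq_eq_false_iff_ne.2 hts]

/-- The symbol `s` represents a number in the heap `L`: zero is a cell whose first component is its
own name, and a successor is a cell whose first component represents the predecessor. The second
component plays a role only for zero, which is also the empty list. -/
def RepNat (L : Heap) : ℕ → ℕ → Prop
  | 0, s => L.lookup s = some (s, s)
  | n + 1, s => ∃ a d, L.lookup s = some (a, d) ∧ a ≠ s ∧ RepNat L n a

/-- The symbol `s` represents a list of numbers in the heap `L`. The empty list is a cell both of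
whose components are its own name, so its head is zero and it is its own tail, in agreement with
`List.headI` and `List.tail`. -/
def RepList (L : Heap) : List ℕ → ℕ → Prop
  | [], s => L.lookup s = some (s, s)
  | n :: v, s => ∃ a d, L.lookup s = some (a, d) ∧ RepNat L n a ∧ RepList L v d

theorem RepNat.mono {L L' : Heap} (h : L.Subheap L') {n s : ℕ} (hs : RepNat L n s) :
    RepNat L' n s := by
  induction n generalizing s with
  | zero => exact h _ _ hs
  | succ n ih =>
    obtain ⟨a, d, e, hne, ha⟩ := hs
    exact ⟨a, d, h _ _ e, hne, ih ha⟩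

theorem RepList.mono {L L' : Heap} (h : L.Subheap L') {v : List ℕ} {s : ℕ}
    (hs : RepList L v s) : RepList L' v s := by
  induction v generalizing s with
  | nil => exact h _ _ hs
  | cons n v ih =>
    obtain ⟨a, d, e, ha, hd⟩ := hs
    exact ⟨a, d, h _ _ e, ha.mono h, ih hd⟩

theorem RepNat.exists_lookup {L : Heap} {n s : ℕ} (hs : RepNat L n s) :
    ∃ a d, L.lookup s = some (a, d) ∧ RepNat L n.pred a ∧ (s = a ↔ n = 0) := by
  cases n with
  | zero => exact ⟨s, s, hs, hs, by simp⟩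
  | succ n =>
    obtain ⟨a, d, e, hne, ha⟩ := hs
    exact ⟨a, d, e, ha, by simp [hne.symm]⟩

theorem RepList.exists_lookup {L : Heap} {v : List ℕ} {s : ℕ} (hs : RepList L v s) :
    ∃ a d, L.lookup s = some (a, d) ∧ RepNat L v.headI a ∧ RepList L v.tail d := by
  cases v with
  | nil => exact ⟨s, s, hs, hs, hs⟩
  | cons n v => exact hs

theorem RepNat.isZero_failEquiv {L : Heap} {n s : ℕ} (hs : RepNat L n s) :
    FailEquiv (.symEq (.label s) (.app (.app (heapTm L) (.label s)) (.bool true)))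
      (.bool (decide (n = 0))) := by
  obtain ⟨a, d, e, -, hz⟩ := hs.exists_lookup
  simpa [hz] using (heapTm_app_failEquiv e true).symEq_of_label (l := s)

/-! ### Computations: the state and continuation monad -/

/-- The type of heaps. -/
abbrev heapTy : Ty := .arrow .sym (.arrow (.base .bool) .sym)

/-- The type of continuations, which take a symbol and a heap. -/
abbrev contTy : Ty := .arrow .sym (.arrow heapTy (.base .unit))

/-- The type of computations, which take a heap and a continuation and call the continuation with a
symbol and an extended heap. -/
abbrev compTy : Ty := .arrow heapTy (.arrow contTy (.base .unit))

/-- `Answers K L φ P` means that the continuation `K`, called with an extension of the heap `L` and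
a symbol that satisfies `φ` in it, reaches `fail` if and only if `P` holds. -/
structure Answers (K : Tm) (L : Heap) (φ : Heap → ℕ → Prop) (P : Prop) : Prop where
  isValue : IsValue K
  closed : K.Closed
  reachesFail_iff (s : ℕ) (L' : Heap) (hL : L.Subheap L') (hs : φ L' s) :
    ReachesFail (.app (.app K (.label s)) (heapTm L')) ↔ P

/-- `Delivers L M φ` means that the computation `M`, run in the heap `L`, returns a symbol and an
extended heap that satisfy `φ`. This is stated in terms of what every continuation makes of them, so
that the reduction sequence, which depends on the choice of fresh symbols, need not be named.
Moreover, `M` is required to evaluate to a closed value, because `bindFn` takes it as an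
argument. -/
structure Delivers (L : Heap) (M : Tm) (φ : Heap → ℕ → Prop) : Prop where
  evaluates : ∃ V, IsValue V ∧ V.Closed ∧ FailEquiv M V
  reachesFail_iff (K : Tm) (P : Prop) (hK : Answers K L φ P) :
    ReachesFail (.app (.app M (heapTm L)) K) ↔ P

/-- `λm. λf. λh. λk. m h (λs. λh'. f s h' k)`, the monadic bind. -/
def bindFn : Tm :=
  .lam (.lam (.lam (.lam (.app (.app (.var 3) (.var 1))
    (.lam (.lam (.app (.app (.app (.var 4) (.var 1)) (.var 0)) (.var 2))))))))

/-- The computation that runs `M` and then `N`, in which the result of `M` is variable `0`. -/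
def bindTm (M N : Tm) : Tm := .app (.app bindFn M) (.lam N)

/-- The computation `λh. λk. let s = gensym in k s h'`, where `h'` is `h` with a new cell `s` whose
components are both `s`. It allocates zero or the empty list. -/
def nilTm : Tm :=
  .lam (.lam (.app (.lam (.app (.app (.var 1) (.var 0))
    (extendTm (.var 4) (.var 2) (.var 2) (.var 2)))) .gensym))

/-- `λa. λd. λh. λk. let s = gensym in k s h'`, where `h'` is `h` with a new cell `s` whose
components are `a` and `d`. -/
def consFn : Tm :=
  .lam (.lam (.lam (.lam (.app (.lam (.app (.app (.var 1) (.var 0))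
    (extendTm (.var 4) (.var 2) (.var 6) (.var 5)))) .gensym))))

/-- The computation that allocates a cell with components `M` and `N`. -/
def consTm (M N : Tm) : Tm := .app (.app consFn M) N

/-- `λs. λh. λk. k (h s b) h`, the selection of a component of a cell. -/
def componentFn (b : Bool) : Tm :=
  .lam (.lam (.lam (.app (.app (.var 0) (.app (.app (.var 1) (.var 2)) (.bool b))) (.var 1))))

/-- The computation of the head of a list, and of the predecessor of a number. -/
def headTm (M : Tm) : Tm := .app (componentFn true) M

/-- The computation of the tail of a list. -/
def tailTm (M : Tm) : Tm := .app (componentFn false) M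

/-- `λs. λf. λg. λh. λk. if s = h s true then f s h k else g s h k`, the case distinction on whether
a number is zero. -/
def ifZeroFn : Tm :=
  .lam (.lam (.lam (.lam (.lam (.cond
    (.symEq (.var 4) (.app (.app (.var 1) (.var 4)) (.bool true)))
    (.app (.app (.app (.var 3) (.var 4)) (.var 1)) (.var 0))
    (.app (.app (.app (.var 2) (.var 4)) (.var 1)) (.var 0)))))))

/-- The computation that continues as `N₀` or `N₁` according to whether the number `M` is zero. In
`N₀` and `N₁`, variable `0` is that number, because only a function delays its body until
it is selected. -/
def ifZeroTm (M N₀ N₁ : Tm) : Tm := .app (.app (.app ifZeroFn M) (.lam N₀)) (.lam N₁)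

@[simp]
theorem bindTm_subst (M N : Tm) (σ : ℕ → Tm) :
    (bindTm M N).subst σ = bindTm (M.subst σ) (N.subst (upSub σ)) :=
  rfl

@[simp]
theorem bindTm_rename (M N : Tm) (ρ : ℕ → ℕ) :
    (bindTm M N).rename ρ = bindTm (M.rename ρ) (N.rename (upRen ρ)) :=
  rfl

@[simp]
theorem nilTm_subst (σ : ℕ → Tm) : nilTm.subst σ = nilTm :=
  rfl

@[simp]
theorem nilTm_rename (ρ : ℕ → ℕ) : nilTm.rename ρ = nilTm :=
  rfl

@[simp]
theorem consTm_subst (M N : Tm) (σ : ℕ → Tm) :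
    (consTm M N).subst σ = consTm (M.subst σ) (N.subst σ) :=
  rfl

@[simp]
theorem consTm_rename (M N : Tm) (ρ : ℕ → ℕ) :
    (consTm M N).rename ρ = consTm (M.rename ρ) (N.rename ρ) :=
  rfl

@[simp]
theorem headTm_subst (M : Tm) (σ : ℕ → Tm) : (headTm M).subst σ = headTm (M.subst σ) :=
  rfl

@[simp]
theorem headTm_rename (M : Tm) (ρ : ℕ → ℕ) : (headTm M).rename ρ = headTm (M.rename ρ) :=
  rfl

@[simp]
theorem tailTm_subst (M : Tm) (σ : ℕ → Tm) : (tailTm M).subst σ = tailTm (M.subst σ) :=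
  rfl

@[simp]
theorem tailTm_rename (M : Tm) (ρ : ℕ → ℕ) : (tailTm M).rename ρ = tailTm (M.rename ρ) :=
  rfl

@[simp]
theorem ifZeroTm_subst (M N₀ N₁ : Tm) (σ : ℕ → Tm) :
    (ifZeroTm M N₀ N₁).subst σ =
      ifZeroTm (M.subst σ) (N₀.subst (upSub σ)) (N₁.subst (upSub σ)) :=
  rfl

@[simp]
theorem ifZeroTm_rename (M N₀ N₁ : Tm) (ρ : ℕ → ℕ) :
    (ifZeroTm M N₀ N₁).rename ρ =
      ifZeroTm (M.rename ρ) (N₀.rename (upRen ρ)) (N₁.rename (upRen ρ)) :=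
  rfl

section Typing

variable {Γ : List Ty} {M N N₀ N₁ : Tm}

theorem typed_bindTm (hM : Typed Γ M compTy) (hN : Typed (.sym :: Γ) N compTy) :
    Typed Γ (bindTm M N) compTy := by
  refine .app (.app ?_ hM) (.lam hN)
  repeat' constructor

theorem typed_nilTm : Typed Γ nilTm compTy := by
  repeat' constructor

theorem typed_consTm (hM : Typed Γ M .sym) (hN : Typed Γ N .sym) :
    Typed Γ (consTm M N) compTy := by
  refine .app (.app ?_ hM) hN
  repeat' constructor

theorem typed_headTm (hM : Typed Γ M .sym) : Typed Γ (headTm M) compTy := by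
  refine .app ?_ hM
  repeat' constructor

theorem typed_tailTm (hM : Typed Γ M .sym) : Typed Γ (tailTm M) compTy := by
  refine .app ?_ hM
  repeat' constructor

theorem typed_ifZeroTm (hM : Typed Γ M .sym) (hN₀ : Typed (.sym :: Γ) N₀ compTy)
    (hN₁ : Typed (.sym :: Γ) N₁ compTy) : Typed Γ (ifZeroTm M N₀ N₁) compTy := by
  refine .app (.app (.app ?_ hM) (.lam hN₀)) (.lam hN₁)
  repeat' constructor

end Typing

theorem Answers.mono {K : Tm} {L L' : Heap} {φ : Heap → ℕ → Prop} {P : Prop}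
    (hK : Answers K L φ P) (hL : L.Subheap L') : Answers K L' φ P where
  isValue := hK.isValue
  closed := hK.closed
  reachesFail_iff s L'' hL' hs := hK.reachesFail_iff s L'' (hL.trans hL') hs

theorem Answers.bind {K N : Tm} {L : Heap} {φ ψ : Heap → ℕ → Prop} {P : Prop}
    (hK : Answers K L ψ P) (hN : (Tm.lam N).Closed)
    (h : ∀ s L', L.Subheap L' → φ L' s → Delivers L' (N.inst (.label s)) ψ) :
    Answers (.lam (.lam (.app (.app (.app (.lam N) (.var 1)) (.var 0)) K))) L φ P where
  isValue := .lam _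
  closed := by
    constructor <;> intro <;>
      simp [Tm.subst, Tm.rename, upSub, upRen, hN.subst_upSub, hN.rename_upRen,
        hK.closed.subst_eq, hK.closed.rename_eq]
  reachesFail_iff s L' hL hs := by
    refine (FailEquiv.beta₂ _ (.label s) (isValue_heapTm L')).reachesFail_iff.trans ?_
    simp only [Tm.subst, upSub, single, Tm.rename, hN.subst_upSub, hK.closed.subst_eq]
    exact (((FailEquiv.beta N (.label s)).appL _).appL _).reachesFail_iff.trans
      ((h s L' hL hs).reachesFail_iff K P (hK.mono hL))

theorem Answers.reachesFail_let_gensym {K A D : Tm} {L : Heap} {φ : Heap → ℕ → Prop} {P : Prop}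
    {a d : ℕ → ℕ} (hK : Answers K L φ P) (h : ∀ s, L.lookup s = none → φ ((s, a s, d s) :: L) s)
    (hA : ∀ s, A.subst (upSub (upSub (single (.label s)))) = .label (a s))
    (hD : ∀ s, D.subst (upSub (upSub (single (.label s)))) = .label (d s)) :
    ReachesFail
      (.app (.lam (.app (.app K (.var 0)) (extendTm (heapTm L) (.var 2) A D))) .gensym) ↔ P := by
  refine BPCFL.reachesFail_let_gensym fun s hs => ?_
  simp only [extendTm, Tm.Occurs, not_or] at hs
  have fresh : L.lookup s = none := lookup_eq_none_of_not_occurs (by tauto)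
  simpa [Tm.inst, Tm.subst, upSub, single, Tm.rename, hK.closed.subst_eq, hA, hD, heapTm,
    extendTm] using hK.reachesFail_iff s ((s, a s, d s) :: L) (.cons fresh _) (h s fresh)

namespace Delivers

variable {L : Heap} {φ ψ : Heap → ℕ → Prop}

theorem of_failEquiv {M N : Tm} (h : FailEquiv M N) (hN : Delivers L N φ) : Delivers L M φ where
  evaluates :=
    let ⟨V, hV, hc, hNV⟩ := hN.evaluates
    ⟨V, hV, hc, h.trans hNV⟩
  reachesFail_iff K P hK := ((h.appL _).appL _).reachesFail_iff.trans (hN.reachesFail_iff K P hK)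

theorem of_lam_lam {B : Tm} (hB : (Tm.lam (.lam B)).Closed)
    (h : ∀ K P, Answers K L φ P →
      (ReachesFail ((B.subst (upSub (single (heapTm L)))).subst (single K)) ↔ P)) :
    Delivers L (.lam (.lam B)) φ where
  evaluates := ⟨_, .lam _, hB, .refl _⟩
  reachesFail_iff K P hK :=
    (FailEquiv.beta₂ B (isValue_heapTm L) hK.isValue).reachesFail_iff.trans (h K P hK)

theorem beta {M : Tm} {s : ℕ} (h : Delivers L (M.inst (.label s)) φ) :
    Delivers L (.app (.lam M) (.label s)) φ :=
  .of_failEquiv (.beta M (.label s)) h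

theorem bind {M N : Tm} (hN : (Tm.lam N).Closed) (hM : Delivers L M φ)
    (h : ∀ s L', L.Subheap L' → φ L' s → Delivers L' (N.inst (.label s)) ψ) :
    Delivers L (bindTm M N) ψ := by
  obtain ⟨V, hV, hVc, hMV⟩ := hM.evaluates
  refine .of_failEquiv (((hMV.appR (.lam _)).appL _).trans (.beta₂ _ hV (.lam N))) ?_
  refine .of_lam_lam ?_ fun K P hK => ?_
  · constructor <;> intro <;>
      simp [Tm.subst, Tm.rename, upSub, upRen, single, hVc.subst_eq, hVc.rename_eq,
        hN.subst_upSub, hN.rename_upRen]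
  simp only [Tm.subst, upSub, single, Tm.rename, hVc.subst_eq, hVc.rename_eq, hN.subst_upSub,
    hN.rename_upRen, heapTm_subst, heapTm_rename, hK.closed.rename_eq]
  exact ((hMV.appL _).appL _).reachesFail_iff.symm.trans
    (hM.reachesFail_iff _ P (hK.bind hN h))

theorem nil (h : ∀ s, L.lookup s = none → φ ((s, s, s) :: L) s) : Delivers L nilTm φ := by
  refine .of_lam_lam ⟨fun _ => rfl, fun _ => rfl⟩ fun K P hK => ?_
  simp only [Tm.subst, upSub, single, Tm.rename, extendTm, heapTm_rename, heapTm_subst,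
    hK.closed.rename_eq]
  exact hK.reachesFail_let_gensym h (fun _ => rfl) fun _ => rfl

theorem cons {a d : ℕ} (h : ∀ s, L.lookup s = none → φ ((s, a, d) :: L) s) :
    Delivers L (consTm (.label a) (.label d)) φ := by
  refine .of_failEquiv (.beta₂ _ (.label a) (.label d)) ?_
  refine .of_lam_lam ⟨fun _ => rfl, fun _ => rfl⟩ fun K P hK => ?_
  simp only [Tm.subst, upSub, single, Tm.rename, extendTm, heapTm_rename, heapTm_subst,
    hK.closed.rename_eq]
  exact hK.reachesFail_let_gensym h (fun _ => rfl) fun _ => rfl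

theorem component {b : Bool} {s a d : ℕ} (hs : L.lookup s = some (a, d))
    (h : φ L (bif b then a else d)) :
    Delivers L (.app (componentFn b) (.label s)) φ := by
  refine .beta (.of_lam_lam ⟨fun _ => rfl, fun _ => rfl⟩ fun K P hK => ?_)
  simp only [Tm.subst, upSub, single, Tm.rename, heapTm_rename, heapTm_subst]
  exact (((heapTm_app_failEquiv hs b).appR hK.isValue).appL _).reachesFail_iff.trans
    (hK.reachesFail_iff _ L (.refl L) h)

theorem ifZero {N₀ N₁ : Tm} {n s : ℕ} (hN₀ : (Tm.lam N₀).Closed) (hN₁ : (Tm.lam N₁).Closed)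
    (hs : RepNat L n s) (h₀ : n = 0 → Delivers L (N₀.inst (.label s)) φ)
    (h₁ : n ≠ 0 → Delivers L (N₁.inst (.label s)) φ) :
    Delivers L (ifZeroTm (.label s) N₀ N₁) φ := by
  refine .of_failEquiv (.beta₃ _ (.label s) (.lam N₀) (.lam N₁)) ?_
  refine .of_lam_lam ?_ fun K P hK => ?_
  · constructor <;> intro <;>
      simp [Tm.subst, Tm.rename, upSub, upRen, single, hN₀.subst_upSub, hN₀.rename_upRen,
        hN₁.subst_upSub, hN₁.rename_upRen]
  simp only [Tm.subst, upSub, single, Tm.rename, heapTm_rename, heapTm_subst, hN₀.subst_upSub,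
    hN₀.rename_upRen, hN₁.subst_upSub, hN₁.rename_upRen]
  refine (hs.isZero_failEquiv.cond_of_bool _ _).reachesFail_iff.trans ?_
  by_cases hn : n = 0
  · rw [decide_eq_true hn]
    exact (beta (h₀ hn)).reachesFail_iff K P hK
  · rw [decide_eq_false hn]
    exact (beta (h₁ hn)).reachesFail_iff K P hK

end Delivers

section Data

variable {L : Heap} {n s t : ℕ} {v : List ℕ}

theorem delivers_nilTm_zero : Delivers L nilTm (RepNat · 0) :=
  .nil fun _ _ => List.lookup_cons_self

theorem delivers_nilTm_nil : Delivers L nilTm (RepList · []) :=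
  .nil fun _ _ => List.lookup_cons_self

theorem delivers_consTm_succ (hs : RepNat L n s) (t : ℕ) :
    Delivers L (consTm (.label s) (.label t)) (RepNat · (n + 1)) := by
  refine .cons fun r fresh => ⟨s, t, List.lookup_cons_self, ?_, hs.mono (.cons fresh _)⟩
  obtain ⟨a, d, e, -⟩ := hs.exists_lookup
  rintro rfl
  simp [fresh] at e

theorem delivers_consTm_cons (hs : RepNat L n s) (ht : RepList L v t) :
    Delivers L (consTm (.label s) (.label t)) (RepList · (n :: v)) :=
  .cons fun _ fresh =>
    ⟨s, t, List.lookup_cons_self, hs.mono (.cons fresh _), ht.mono (.cons fresh _)⟩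

theorem delivers_headTm_pred (hs : RepNat L n s) :
    Delivers L (headTm (.label s)) (RepNat · n.pred) :=
  let ⟨_, _, e, ha, _⟩ := hs.exists_lookup
  .component e ha

theorem delivers_headTm_headI (hs : RepList L v s) :
    Delivers L (headTm (.label s)) (RepNat · v.headI) :=
  let ⟨_, _, e, ha, _⟩ := hs.exists_lookup
  .component e ha

theorem delivers_tailTm (hs : RepList L v s) :
    Delivers L (tailTm (.label s)) (RepList · v.tail) :=
  let ⟨_, _, e, _, hd⟩ := hs.exists_lookup
  .component e hd

end Data

/-! ### Compilation of partial recursive functions -/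

open Turing.ToPartrec (Code)

/-- The expression of type `sym → compTy` that implements a program on lists of numbers. -/
def compile : Code → Tm
  | .zero' => .lam (bindTm nilTm (consTm (.var 0) (.var 1)))
  | .succ => .lam (bindTm (headTm (.var 0)) (bindTm (consTm (.var 0) (.var 0))
      (bindTm nilTm (consTm (.var 1) (.var 0)))))
  | .tail => .lam (tailTm (.var 0))
  | .cons f fs => .lam (bindTm (.app (compile f) (.var 0)) (bindTm (.app (compile fs) (.var 1))
      (bindTm (headTm (.var 1)) (consTm (.var 0) (.var 1)))))
  | .comp f g => .lam (bindTm (.app (compile g) (.var 0)) (.app (compile f) (.var 0)))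
  | .case f g => .lam (bindTm (headTm (.var 0)) (ifZeroTm (.var 0)
      (bindTm (tailTm (.var 2)) (.app (compile f) (.var 0)))
      (bindTm (headTm (.var 0)) (bindTm (tailTm (.var 3)) (bindTm (consTm (.var 1) (.var 0))
        (.app (compile g) (.var 0)))))))
  | .fix f => .fix (bindTm (.app (compile f) (.var 0)) (bindTm (headTm (.var 0))
      (ifZeroTm (.var 0) (tailTm (.var 2))
        (bindTm (tailTm (.var 2)) (.app (.var 5) (.var 0))))))

theorem typed_compile (c : Code) (Γ : List Ty) : Typed Γ (compile c) (.arrow .sym compTy) := by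
  induction c generalizing Γ with
  | zero' => exact .lam (typed_bindTm typed_nilTm (typed_consTm (.var rfl) (.var rfl)))
  | succ =>
    exact .lam (typed_bindTm (typed_headTm (.var rfl)) (typed_bindTm
      (typed_consTm (.var rfl) (.var rfl)) (typed_bindTm typed_nilTm
        (typed_consTm (.var rfl) (.var rfl)))))
  | tail => exact .lam (typed_tailTm (.var rfl))
  | cons f fs hf hfs =>
    exact .lam (typed_bindTm (.app (hf _) (.var rfl)) (typed_bindTm (.app (hfs _) (.var rfl))
      (typed_bindTm (typed_headTm (.var rfl)) (typed_consTm (.var rfl) (.var rfl)))))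
  | comp f g hf hg =>
    exact .lam (typed_bindTm (.app (hg _) (.var rfl)) (.app (hf _) (.var rfl)))
  | case f g hf hg =>
    exact .lam (typed_bindTm (typed_headTm (.var rfl)) (typed_ifZeroTm (.var rfl)
      (typed_bindTm (typed_tailTm (.var rfl)) (.app (hf _) (.var rfl)))
      (typed_bindTm (typed_headTm (.var rfl)) (typed_bindTm (typed_tailTm (.var rfl))
        (typed_bindTm (typed_consTm (.var rfl) (.var rfl)) (.app (hg _) (.var rfl)))))))
  | fix f hf =>
    exact .fix (typed_bindTm (.app (hf _) (.var rfl)) (typed_bindTm (typed_headTm (.var rfl))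
      (typed_ifZeroTm (.var rfl) (typed_tailTm (.var rfl))
        (typed_bindTm (typed_tailTm (.var rfl)) (.app (.var rfl) (.var rfl))))))

@[simp]
theorem compile_subst (c : Code) (σ : ℕ → Tm) : (compile c).subst σ = compile c := by
  induction c generalizing σ <;> simp_all [compile, Tm.subst, upSub, Tm.rename]

@[simp]
theorem compile_rename (c : Code) (ρ : ℕ → ℕ) : (compile c).rename ρ = compile c := by
  induction c generalizing ρ <;> simp_all [compile, Tm.rename, upRen]

/-- `Computes F v v'` means that `F` maps every representation of the list `v` to a computation of a
representation of the list `v'`. -/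
def Computes (F : Tm) (v v' : List ℕ) : Prop :=
  ∀ L s, RepList L v s → Delivers L (.app F (.label s)) (RepList · v')

attribute [local simp] Tm.inst Tm.subst Tm.rename upSub upRen single

theorem computes_zero' (v : List ℕ) : Computes (compile .zero') v (0 :: v) := by
  intro L s hs
  refine .beta (.bind ⟨fun _ => rfl, fun _ => rfl⟩ delivers_nilTm_zero fun z L₁ hL₁ hz => ?_)
  exact delivers_consTm_cons hz (hs.mono hL₁)

theorem computes_succ (v : List ℕ) : Computes (compile .succ) v [v.headI + 1] := by
  intro L s hs
  refine .beta (.bind ⟨fun _ => rfl, fun _ => rfl⟩ (delivers_headTm_headI hs)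
    fun n L₁ _ hn => ?_)
  refine .bind ⟨fun _ => rfl, fun _ => rfl⟩ (delivers_consTm_succ hn _) fun n' L₂ _ hn' => ?_
  refine .bind ⟨fun _ => rfl, fun _ => rfl⟩ delivers_nilTm_nil fun z L₃ hL₃ hz => ?_
  exact delivers_consTm_cons (hn'.mono hL₃) hz

theorem computes_tail (v : List ℕ) : Computes (compile .tail) v v.tail :=
  fun _ _ hs => .beta (delivers_tailTm hs)

theorem computes_cons {f fs : Code} {v v₁ v₂ : List ℕ} (hf : Computes (compile f) v v₁)
    (hfs : Computes (compile fs) v v₂) :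
    Computes (compile (.cons f fs)) v (v₁.headI :: v₂) := by
  intro L s hs
  refine .beta (.bind (φ := (RepList · v₁)) ⟨by simp, by simp⟩ (by simpa using hf L s hs)
    fun s₁ L₁ hL₁ hs₁ => ?_)
  refine .bind (φ := (RepList · v₂)) ⟨by simp, by simp⟩ (by simpa using hfs L₁ s (hs.mono hL₁))
    fun s₂ L₂ hL₂ hs₂ => ?_
  refine .bind ⟨by simp, by simp⟩ (delivers_headTm_headI (hs₁.mono hL₂)) fun n L₃ hL₃ hn => ?_
  exact delivers_consTm_cons hn (hs₂.mono hL₃)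

theorem computes_comp {f g : Code} {v v' v'' : List ℕ} (hg : Computes (compile g) v v')
    (hf : Computes (compile f) v' v'') : Computes (compile (.comp f g)) v v'' := by
  intro L s hs
  refine .beta (.bind (φ := (RepList · v')) ⟨by simp, by simp⟩ (by simpa using hg L s hs)
    fun s' L' _ hs' => ?_)
  simpa using hf L' s' hs'

theorem computes_case_zero {f g : Code} {v v' : List ℕ} (h : v.headI = 0)
    (hf : Computes (compile f) v.tail v') : Computes (compile (.case f g)) v v' := by
  intro L s hs
  refine .beta (.bind ⟨by simp, by simp⟩ (delivers_headTm_headI hs) fun n L₁ hL₁ hn => ?_)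
  refine .ifZero ⟨by simp, by simp⟩ ⟨by simp, by simp⟩ hn (fun _ => ?_) (absurd h)
  refine .bind ⟨by simp, by simp⟩ (delivers_tailTm (hs.mono hL₁)) fun t L₂ _ ht => ?_
  simpa using hf L₂ t ht

theorem computes_case_succ {f g : Code} {v v' : List ℕ} (h : v.headI ≠ 0)
    (hg : Computes (compile g) (v.headI.pred :: v.tail) v') :
    Computes (compile (.case f g)) v v' := by
  intro L s hs
  refine .beta (.bind ⟨by simp, by simp⟩ (delivers_headTm_headI hs) fun n L₁ hL₁ hn => ?_)
  refine .ifZero ⟨by simp, by simp⟩ ⟨by simp, by simp⟩ hn (fun h' => absurd h' h) fun _ => ?_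
  refine .bind ⟨by simp, by simp⟩ (delivers_headTm_pred hn) fun m L₂ hL₂ hm => ?_
  refine .bind ⟨by simp, by simp⟩ (delivers_tailTm ((hs.mono hL₁).mono hL₂)) fun t L₃ hL₃ ht => ?_
  refine .bind ⟨by simp, by simp⟩ (delivers_consTm_cons (hm.mono hL₃) ht) fun w L₄ _ hw => ?_
  simpa using hg L₄ w hw

theorem computes_fix {f : Code} {v r v' : List ℕ} (hf : Computes (compile f) v r)
    (h₀ : r.headI = 0 → v' = r.tail)
    (h₁ : r.headI ≠ 0 → Computes (compile (.fix f)) r.tail v') :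
    Computes (compile (.fix f)) v v' := by
  intro L s hs
  refine .of_failEquiv ((Contracts.fix _).failEquiv.appL _) (.beta ?_)
  rw [← compile]
  refine .bind (φ := (RepList · r)) ⟨by simp, by simp⟩ (by simpa using hf L s hs)
    fun s₁ L₁ _ hs₁ => ?_
  refine .bind ⟨by simp, by simp⟩ (delivers_headTm_headI hs₁) fun n L₂ hL₂ hn => ?_
  refine .ifZero ⟨by simp, by simp⟩ ⟨by simp, by simp⟩ hn (fun h => ?_) fun h => ?_
  · rw [h₀ h]
    exact delivers_tailTm (hs₁.mono hL₂)
  · refine .bind ⟨by simp, by simp⟩ (delivers_tailTm (hs₁.mono hL₂)) fun t L₃ _ ht => ?_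
    simpa using h₁ h L₃ t ht

theorem computes_compile {c : Code} {v v' : List ℕ} (h : v' ∈ c.eval v) :
    Computes (compile c) v v' := by
  induction c generalizing v v' with
  | zero' =>
    simp only [Code.zero'_eval, Part.pure_eq_some, Part.mem_some_iff] at h
    exact h ▸ computes_zero' v
  | succ =>
    simp only [Code.succ_eval, Part.pure_eq_some, Part.mem_some_iff] at h
    exact h ▸ computes_succ v
  | tail =>
    simp only [Code.tail_eval, Part.pure_eq_some, Part.mem_some_iff] at h
    exact h ▸ computes_tail v
  | cons f fs ihf ihfs =>
    simp only [Code.cons_eval, Part.bind_eq_bind, Part.mem_bind_iff, Part.pure_eq_some,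
      Part.mem_some_iff] at h
    obtain ⟨v₁, h₁, v₂, h₂, rfl⟩ := h
    exact computes_cons (ihf h₁) (ihfs h₂)
  | comp f g ihf ihg =>
    rw [Code.comp_eval] at h
    obtain ⟨v₁, h₁, h₂⟩ := Part.mem_bind_iff.1 h
    exact computes_comp (ihg h₁) (ihf h₂)
  | case f g ihf ihg =>
    simp only [Code.case_eval] at h
    cases hn : v.headI with
    | zero => exact computes_case_zero hn (ihf (by simpa [hn] using h))
    | succ n => exact computes_case_succ (by simp [hn]) (ihg (by simpa [hn] using h))
  | fix f ih =>
    rw [Code.fix_eval] at h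
    refine PFun.fixInduction' (C := fun v => Computes _ v v') h (fun v hv => ?_)
      fun v w _ hv hw => ?_
    all_goals
      obtain ⟨r, hr, e⟩ := (Part.mem_map_iff _).1 hv
      refine computes_fix (ih hr) (fun h₀ => ?_) fun h₁ => ?_
      all_goals grind

/-! ### The reduction -/

/-- The computation that allocates the number `n`. -/
def numeralTm : ℕ → Tm
  | 0 => nilTm
  | n + 1 => bindTm (numeralTm n) (consTm (.var 0) (.var 0))

theorem typed_numeralTm (n : ℕ) (Γ : List Ty) : Typed Γ (numeralTm n) compTy := by
  induction n with
  | zero => exact typed_nilTm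
  | succ n ih => exact typed_bindTm ih (typed_consTm (.var rfl) (.var rfl))

theorem delivers_numeralTm (n : ℕ) (L : Heap) : Delivers L (numeralTm n) (RepNat · n) := by
  induction n with
  | zero => exact delivers_nilTm_zero
  | succ n ih =>
    exact .bind ⟨fun _ => rfl, fun _ => rfl⟩ ih fun s _ _ hs => delivers_consTm_succ hs s

/-- The computation of the head of the result of `c` on the list whose only entry is `n`. -/
def runTm (c : Code) (n : ℕ) : Tm :=
  bindTm (numeralTm n) (bindTm nilTm (bindTm (consTm (.var 1) (.var 0))
    (bindTm (.app (compile c) (.var 0)) (headTm (.var 0)))))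

theorem typed_runTm (c : Code) (n : ℕ) (Γ : List Ty) : Typed Γ (runTm c n) compTy :=
  typed_bindTm (typed_numeralTm n _) (typed_bindTm typed_nilTm
    (typed_bindTm (typed_consTm (.var rfl) (.var rfl))
      (typed_bindTm (.app (typed_compile c _) (.var rfl)) (typed_headTm (.var rfl)))))

theorem delivers_runTm {c : Code} {n : ℕ} {v : List ℕ} (h : v ∈ c.eval [n]) (L : Heap) :
    Delivers L (runTm c n) (RepNat · v.headI) := by
  refine .bind ⟨by simp, by simp⟩ (delivers_numeralTm n L) fun s L₁ _ hs => ?_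
  refine .bind ⟨by simp, by simp⟩ delivers_nilTm_nil fun z L₂ hL₂ hz => ?_
  refine .bind ⟨by simp, by simp⟩ (delivers_consTm_cons (hs.mono hL₂) hz) fun l L₃ _ hl => ?_
  refine .bind (φ := (RepList · v)) ⟨by simp, by simp⟩
    (by simpa using computes_compile h L₃ l hl) fun r L₄ _ hr => ?_
  exact delivers_headTm_headI hr

/-- The continuation `λs. λh. if s = h s true then fail else ()`. -/
def failIfZeroTm : Tm :=
  .lam (.lam (.cond (.symEq (.var 1) (.app (.app (.var 0) (.var 1)) (.bool true))) .fail .unit))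

theorem answers_failIfZeroTm (L : Heap) (n : ℕ) :
    Answers failIfZeroTm L (RepNat · n) (n = 0) where
  isValue := .lam _
  closed := ⟨fun _ => rfl, fun _ => rfl⟩
  reachesFail_iff s L' _ hs := by
    refine (FailEquiv.beta₂ _ (.label s) (isValue_heapTm L')).reachesFail_iff.trans ?_
    refine (hs.isZero_failEquiv.cond_of_bool _ _).reachesFail_iff.trans ?_
    by_cases h : n = 0
    · rw [decide_eq_true h]
      exact iff_of_true .refl h
    · rw [decide_eq_false h]
      exact iff_of_false IsValue.unit.not_reachesFail h

/-- The program that fails if `c` returns a list with head zero on the list whose only entry is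
`n`. -/
def reductionTm (c : Code) (n : ℕ) : Tm :=
  .app (.app (runTm c n) (heapTm [])) failIfZeroTm

theorem typed_reductionTm (c : Code) (n : ℕ) : Typed [] (reductionTm c n) (.base .unit) := by
  refine .app (.app (typed_runTm c n []) (.lam (.lam (.var rfl)))) ?_
  repeat' constructor

theorem reachesFail_reductionTm {c : Code} {n : ℕ} {v : List ℕ} (h : v ∈ c.eval [n]) :
    ReachesFail (reductionTm c n) ↔ v.headI = 0 :=
  (delivers_runTm h []).reachesFail_iff _ _ (answers_failIfZeroTm [] _)

theorem primrec_code_numeralTm : Primrec fun n => (numeralTm n).code := by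
  have step : Primrec₂ fun _ m : ℕ => Nat.pair 5 (Nat.pair (Nat.pair 5 (Nat.pair bindFn.code m))
      (Tm.lam (consTm (.var 0) (.var 0))).code) :=
    Primrec₂.natPair.comp (.const 5) (Primrec₂.natPair.comp
      (Primrec₂.natPair.comp (.const 5) (Primrec₂.natPair.comp (.const _) .snd)) (.const _))
  refine (Primrec.nat_rec₁ nilTm.code step).of_eq fun n => ?_
  induction n with
  | zero => rfl
  | succ n ih => simp [numeralTm, bindTm, Tm.code, ← ih]

theorem primrec_code_reductionTm (c : Code) : Primrec fun n => (reductionTm c n).code := by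
  have code_appL {f : ℕ → Tm} (hf : Primrec fun n => (f n).code) (M : Tm) :
      Primrec fun n => (Tm.app (f n) M).code :=
    Primrec₂.natPair.comp (.const 5) (Primrec₂.natPair.comp hf (.const _))
  have code_appR {f : ℕ → Tm} (hf : Primrec fun n => (f n).code) (M : Tm) :
      Primrec fun n => (Tm.app M (f n)).code :=
    Primrec₂.natPair.comp (.const 5) (Primrec₂.natPair.comp (.const _) hf)
  exact code_appL (code_appL (code_appL (code_appR primrec_code_numeralTm _) _) _) _

theorem exists_reduction_of_partrec {u : ℕ →. ℕ} (hu : Partrec u) :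
    ∃ T : ℕ → Tm, Computable (fun n => (T n).code) ∧ (∀ n, Typed [] (T n) (.base .unit)) ∧
      ∀ n, ∀ x ∈ u n, (ReachesFail (T n) ↔ x = 0) := by
  obtain ⟨c, hc⟩ := Code.exists_code (Nat.Partrec'.part_iff₁.2 hu)
  refine ⟨reductionTm c, (primrec_code_reductionTm c).to_comp, typed_reductionTm c,
    fun n x hx => ?_⟩
  have eval_eq : c.eval [n] = pure <$> u n := hc (n ::ᵥ .nil)
  exact reachesFail_reductionTm (v := [x]) (eval_eq ▸ Part.mem_map _ hx)

/-! ### Diagonalization -/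

/-- The partial recursive function whose value at `e` is that of the function with code `e`. -/
def selfApply (e : ℕ) : Part ℕ :=
  (Denumerable.ofNat Nat.Partrec.Code e).eval e

theorem partrec_selfApply : Partrec selfApply :=
  Nat.Partrec.Code.eval_part.comp (Computable.ofNat _) Computable.id

theorem exists_selfApply_eq {g : ℕ →. ℕ} (hg : Partrec g) : ∃ e, selfApply e = g e := by
  obtain ⟨d, rfl⟩ := Nat.Partrec.Code.exists_code.1 (Partrec.nat_iff.1 hg)
  exact ⟨Encodable.encode d, by rw [selfApply, Denumerable.ofNat_encode]⟩

end BPCFL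

theorem mainTheorem3 : ¬ ∃ f : ℕ →. Bool, Partrec f ∧ BPCFL.SolvesReachability f := by
  rintro ⟨f, hf, hsolves⟩
  obtain ⟨T, hT, hT_typed, hT_iff⟩ :=
    BPCFL.exists_reduction_of_partrec BPCFL.partrec_selfApply
  have hg : Partrec fun n => (f (T n).code).map fun r => bif r then 1 else 0 :=
    (hf.comp hT).map (Primrec.cond .snd (.const 1) (.const 0)).to_comp.to₂
  obtain ⟨e, he⟩ := BPCFL.exists_selfApply_eq hg
  obtain ⟨r, hr, hr_iff⟩ := hsolves (T e) .unit (hT_typed e)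
  have value_mem : (bif r then 1 else 0) ∈ BPCFL.selfApply e := he ▸ Part.mem_map _ hr
  rw [hT_iff e _ value_mem] at hr_iff
  cases r <;> simp at hr_iff
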